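/- Let $\mathbb{R}_+=[0,\infty)$, $\overline{\mathbb{R}}_+=[0,\infty]$, $n\in\mathbb{N}$, and let $C_{\lim}(\mathbb{R}_+,\mathbb{R}^n)$ be the space of all continuous functions $x:\mathbb{R}_+\to\mathbb{R}^n$ for which the limit $x(\infty)=\lim_{t\to\infty}x(t)$ exists in $\mathbb{R}^n$, equipped with the supremum norm. For such $x$ put $x_0(t)=x(t)-x(\infty)$, so that $x_0\in C_0(\mathbb{R}_+,\mathbb{R}^n)$. Signed measures are finite. A signed Borel measure is regular if its total variation is a regular measure. Let $\mathscr{M}(\overline{\mathbb{R}}_+)$ be the set of signed Borel measures $\mu$ on $[0,\infty]$ that have a unique representation $\mu=\mu_0+\mu_\infty$ with a regular signed Borel measure $\mu_0$ on $\mathbb{R}_+$ and a finite signed measure $\mu_\infty$ concentrated at the point $\infty$. For a vector $\nu=(\nu_1,\dots,\nu_n)$ of signed measures write $\int\langle f,d\nu\rangle=\sum_{i=1}^n\int f_i\,d\nu_i$. Let $x^*$ be a continuous linear functional on $C_{\lim}(\mathbb{R}_+,\mathbb{R}^n)$. Then: (1) There is exactly one pair $(\nu,\alpha)$, consisting of a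 vector $\nu=(\nu_1,\dots,\nu_n)$ of regular signed Borel measures on $\mathbb{R}_+$ and a vector $\alpha\in\mathbb{R}^n$, such that for all $x\in C_{\lim}(\mathbb{R}_+,\mathbb{R}^n)$ $$\langle x^*,x\rangle=\int_0^\infty\langle x(t)-x(\infty),d\nu(t)\rangle+\alpha^Tx(\infty)=\int_0^\infty\langle x_0(t),d\nu(t)\rangle+\alpha^Tx(\infty).$$ (2) There is exactly one vector $\mu=(\mu_1,\dots,\mu_n)$ with $\mu_i\in\mathscr{M}(\overline{\mathbb{R}}_+)$ such that for all $x\in C_{\lim}(\mathbb{R}_+,\mathbb{R}^n)$, extended to $[0,\infty]$ by the value $x(\infty)$ at $\infty$, $$\langle x^*,x\rangle=\int_{[0,\infty]}\langle x(t),d\mu(t)\rangle.$$ (3) The two forms are equivalent: for every vector $\nu$ of regular signed Borel measures on $\mathbb{R}_+$ and every $\alpha\in\mathbb{R}^n$, the measures $\mu_i=\nu_i+\big(\alpha_i-\nu_i(\mathbb{R}_+)\big)\delta_\infty$ belong to $\mathscr{M}(\overline{\mathbb{R}}_+)$, and $(\nu,\alpha)$ represents $x^*$ as in (1) if and only if $\mu=(\mu_1,\dots,\mu_n)$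 represents $x^*$ as in (2). -/

import Mathlib

open MeasureTheory Filter Topology
open scoped NNReal ENNReal BoundedContinuousFunction ZeroAtInfty

noncomputable section

/-- `C_lim(ℝ₊, ℝⁿ)`: the continuous functions `x : [0, ∞) → ℝⁿ` that converge in `ℝⁿ` as `t → ∞`,
with the supremum norm. Such functions are automatically bounded, see `CLim.exists_coe_eq_iff`;
the space is therefore a subspace of the bounded continuous functions. -/
def CLim (n : ℕ) : Submodule ℝ (ℝ≥0 →ᵇ EuclideanSpace ℝ (Fin n)) where
  carrier := {x | ∃ a : EuclideanSpace ℝ (Fin n), Tendsto x atTop (𝓝 a)}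
  zero_mem' := ⟨0, tendsto_const_nhds⟩
  add_mem' := by
    rintro x y ⟨a, ha⟩ ⟨b, hb⟩
    exact ⟨a + b, ha.add hb⟩
  smul_mem' := by
    rintro c x ⟨a, ha⟩
    exact ⟨c • a, ha.const_smul c⟩

namespace CLim

variable {n : ℕ}

/-- `CLim n` consists of all continuous functions `[0, ∞) → ℝⁿ` with a limit at infinity. -/
theorem exists_coe_eq_iff (f : ℝ≥0 → EuclideanSpace ℝ (Fin n)) :
    (∃ x : CLim n, ⇑x.1 = f) ↔
      Continuous f ∧ ∃ a : EuclideanSpace ℝ (Fin n), Tendsto f atTop (𝓝 a) := by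
  constructor
  · rintro ⟨x, rfl⟩
    exact ⟨x.1.continuous, x.2⟩
  · rintro ⟨hf, a, ha⟩
    obtain ⟨T, hT⟩ := (eventually_atTop).1 (ha.norm.eventually_le_const (lt_add_one ‖a‖))
    obtain ⟨C, hC⟩ := (isCompact_Icc (a := (0 : ℝ≥0)) (b := T)).exists_bound_of_continuousOn
      hf.continuousOn
    refine ⟨⟨BoundedContinuousFunction.ofNormedAddCommGroup f hf (max C (‖a‖ + 1)) ?_, a, ha⟩, rfl⟩
    intro t
    rcases le_total t T with h | h
    · exact (hC t ⟨zero_le, h⟩).trans (le_max_left _ _)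
    · exact (hT t h).trans (le_max_right _ _)

/-- The limit `x(∞) = lim_{t → ∞} x(t)`. -/
def atInfty (x : CLim n) : EuclideanSpace ℝ (Fin n) := limUnder atTop x.1

theorem tendsto_atInfty (x : CLim n) : Tendsto x.1 atTop (𝓝 (atInfty x)) :=
  tendsto_nhds_limUnder x.2

/-- The part `x₀ = x - x(∞)` of `x` in `C₀(ℝ₊, ℝⁿ)`. -/
def zeroPart (x : CLim n) : C₀(ℝ≥0, EuclideanSpace ℝ (Fin n)) where
  toFun t := x.1 t - CLim.atInfty x
  continuous_toFun := x.1.continuous.sub continuous_const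
  zero_at_infty' := by
    rw [cocompact_eq_atTop]
    simpa using (tendsto_atInfty x).sub_const (atInfty x)

/-- The extension of `x` to `[0, ∞]` by its limit at `∞`. -/
def extend (x : CLim n) (t : ℝ≥0∞) : EuclideanSpace ℝ (Fin n) :=
  if t = ∞ then atInfty x else x.1 t.toNNReal

end CLim

/-- `∫ ⟨f(t), dν(t)⟩ = ∑ᵢ ∫ fᵢ(t) dνᵢ(t)` for a vector `ν = (ν₁, …, νₙ)` of signed measures. -/
def pairingIntegral {X : Type*} [MeasurableSpace X] {n : ℕ}
    (f : X → EuclideanSpace ℝ (Fin n)) (ν : Fin n → SignedMeasure X) : ℝ :=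
  ∑ i, ∫ᵛ t, f t i ∂<•(ν i)

/-- A signed Borel measure is regular if its total variation measure is regular. -/
def IsRegularSigned {X : Type*} [TopologicalSpace X] [MeasurableSpace X]
    (ν : SignedMeasure X) : Prop :=
  ν.totalVariation.Regular

/-- The signed measure `ν + c δ_∞` on `[0, ∞]`, where `ν` is a signed measure on `[0, ∞)`. -/
def addPointMassAtInfty (ν : SignedMeasure ℝ≥0) (c : ℝ) : SignedMeasure ℝ≥0∞ :=
  ν.map ((↑) : ℝ≥0 → ℝ≥0∞) + VectorMeasure.dirac ∞ c

/-- The set `M([0, ∞])` of signed Borel measures on `[0, ∞]` which have a unique representation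
`μ = μ₀ + μ_∞` with a regular signed Borel measure `μ₀` on `[0, ∞)` and a finite signed measure
`μ_∞` concentrated at `∞`. -/
def extendedMeasures : Set (SignedMeasure ℝ≥0∞) :=
  {μ | ∃! p : SignedMeasure ℝ≥0 × ℝ, IsRegularSigned p.1 ∧ μ = addPointMassAtInfty p.1 p.2}

/-- `φ` has the representation
`φ(x) = ∫ ⟨x(t) - x(∞), dν(t)⟩ + αᵀ x(∞) = ∫ ⟨x₀(t), dν(t)⟩ + αᵀ x(∞)`. -/
def IsRepresentedBy {n : ℕ} (φ : CLim n →L[ℝ] ℝ) (ν : Fin n → SignedMeasure ℝ≥0)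
    (α : EuclideanSpace ℝ (Fin n)) : Prop :=
  ∀ x : CLim n,
    φ x = pairingIntegral (fun t ↦ x.1 t - CLim.atInfty x) ν + inner ℝ α (CLim.atInfty x) ∧
    φ x = pairingIntegral (CLim.zeroPart x) ν + inner ℝ α (CLim.atInfty x)

/-- `φ` has the representation `φ(x) = ∫_{[0, ∞]} ⟨x(t), dμ(t)⟩`. -/
def IsRepresentedByExtended {n : ℕ} (φ : CLim n →L[ℝ] ℝ)
    (μ : Fin n → SignedMeasure ℝ≥0∞) : Prop :=
  ∀ x : CLim n, φ x = pairingIntegral (CLim.extend x) μ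

end

/-! Extending by the limit identifies `CLim n` with the continuous functions from the compact space
$[0,\infty]$ to $\mathbb{R}^n$. The Riesz theorem in each coordinate then gives (2); its signed form
follows from the positive one by writing a bounded functional as a difference of positive ones. A
signed measure on $[0,\infty]$ is the same as a signed measure $\nu$ on $[0,\infty)$ together with a
mass at $\infty$ (`addPointMassAtInfty_bijective`), and regularity is automatic. Subtracting
$x(\infty)$ in the integrand costs $\nu_i(\mathbb{R}_+)x_i(\infty)$, so the mass at $\infty$ is
$\alpha_i-\nu_i(\mathbb{R}_+)$. This gives (3), and (1) is (2) transported along the bijection. -/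

/-! ### Riesz representation by signed measures -/

open CompactlySupported CompactlySupportedContinuousMap in
/-- A linear functional on the cone of nonnegative compactly supported functions that is bounded
above on order intervals is the difference of two nonnegative linear functionals. -/
theorem exists_linearMap_nnreal_sub_eq {X : Type*} [TopologicalSpace X]
    (Λ : C_c(X, ℝ≥0) →ₗ[ℝ≥0] ℝ) (hΛ : ∀ f, BddAbove (Λ '' Set.Iic f)) :
    ∃ P N : C_c(X, ℝ≥0) →ₗ[ℝ≥0] ℝ≥0, ∀ f, Λ f = P f - N f := by
  -- Riesz–Kantorovich formula for the positive part of `Λ`; the negative part will be `p - Λ`.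
  set p : C_c(X, ℝ≥0) → ℝ := fun f ↦ sSup (Λ '' Set.Iic f) with hp
  have le_p {f g : C_c(X, ℝ≥0)} (h : g ≤ f) : Λ g ≤ p f := le_csSup (hΛ f) ⟨g, h, rfl⟩
  have p_le {f : C_c(X, ℝ≥0)} {c : ℝ} (h : ∀ g ≤ f, Λ g ≤ c) : p f ≤ c := by
    refine csSup_le ⟨Λ f, f, Set.mem_Iic.2 le_rfl, rfl⟩ ?_
    rintro _ ⟨g, hg, rfl⟩
    exact h g hg
  have p_nonneg (f : C_c(X, ℝ≥0)) : 0 ≤ p f := by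
    simpa using le_p (f := f) (g := 0) (CompactlySupportedContinuousMap.le_def.2 fun a ↦ zero_le)
  have p_add (f g : C_c(X, ℝ≥0)) : p (f + g) = p f + p g := by
    apply le_antisymm
    · refine p_le fun h hh ↦ ?_
      -- Riesz decomposition: `h ≤ f + g` splits as `h ⊓ f` plus a remainder below `g`.
      obtain ⟨k, hk⟩ := CompactlySupportedContinuousMap.exists_add_of_le
        (inf_le_left : h ⊓ f ≤ h)
      have hkg : k ≤ g := by
        rw [CompactlySupportedContinuousMap.le_def] at hh ⊢
        intro a
        have h1 := congr($hk a)
        have h2 := hh a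
        simp only [CompactlySupportedContinuousMap.add_apply, inf_apply] at h1 h2
        rcases le_total (h a) (f a) with h3 | h3
        · rw [inf_eq_left.2 h3] at h1
          rw [add_eq_left.1 h1]
          exact zero_le
        · rw [inf_eq_right.2 h3] at h1
          rw [← h1] at h2
          exact le_of_add_le_add_left h2
      rw [← hk, map_add]
      exact add_le_add (le_p inf_le_right) (le_p hkg)
    · have h1 (u : C_c(X, ℝ≥0)) (hu : u ≤ f) : Λ u + p g ≤ p (f + g) := by
        have : p g ≤ p (f + g) - Λ u := p_le fun v hv ↦ by
          have h2 : Λ (u + v) ≤ p (f + g) :=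
            le_p (CompactlySupportedContinuousMap.le_def.2 fun a ↦ add_le_add (CompactlySupportedContinuousMap.le_def.1 hu a) (CompactlySupportedContinuousMap.le_def.1 hv a))
          rw [map_add] at h2
          linarith
        linarith
      have : p f ≤ p (f + g) - p g := p_le fun u hu ↦ by linarith [h1 u hu]
      linarith
  have p_smul_le (c : ℝ≥0) (f : C_c(X, ℝ≥0)) : c * p f ≤ p (c • f) := by
    rcases eq_or_ne c 0 with rfl | hc
    · simpa using p_nonneg _
    · have hc' : (0 : ℝ) < c := by positivity
      rw [mul_comm, ← le_div_iff₀ hc']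
      refine p_le fun g hg ↦ ?_
      rw [le_div_iff₀ hc', mul_comm]
      have := le_p (f := c • f) (g := c • g)
        (CompactlySupportedContinuousMap.le_def.2 fun a ↦ mul_le_mul_right (CompactlySupportedContinuousMap.le_def.1 hg a) c)
      rwa [map_smul, NNReal.smul_def, smul_eq_mul] at this
  have p_smul (c : ℝ≥0) (f : C_c(X, ℝ≥0)) : p (c • f) = c * p f := by
    refine le_antisymm ?_ (p_smul_le c f)
    rcases eq_or_ne c 0 with rfl | hc
    · simp only [zero_smul, NNReal.coe_zero, zero_mul]
      refine p_le fun g hg ↦ ?_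
      have : g = 0 := le_antisymm hg (CompactlySupportedContinuousMap.le_def.2 fun a ↦ zero_le)
      simp [this]
    -- The reverse inequality is the proved one for the scalar `c⁻¹` and the function `c • f`.
    · have := p_smul_le c⁻¹ (c • f)
      rw [smul_smul, inv_mul_cancel₀ hc, one_smul, NNReal.coe_inv] at this
      rwa [inv_mul_le_iff₀ (by positivity)] at this
  have p_sub_nonneg (f : C_c(X, ℝ≥0)) : 0 ≤ p f - Λ f := sub_nonneg.2 (le_p le_rfl)
  refine ⟨⟨⟨fun f ↦ ⟨p f, p_nonneg f⟩, fun f g ↦ NNReal.eq (p_add f g)⟩,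
    fun c f ↦ NNReal.eq (p_smul c f)⟩,
    ⟨⟨fun f ↦ ⟨p f - Λ f, p_sub_nonneg f⟩, fun f g ↦ NNReal.eq ?_⟩, fun c f ↦ NNReal.eq ?_⟩, ?_⟩
  · change p (f + g) - Λ (f + g) = (p f - Λ f) + (p g - Λ g)
    rw [p_add, map_add]
    ring
  · change p (c • f) - Λ (c • f) = c * (p f - Λ f)
    rw [p_smul, map_smul, NNReal.smul_def, smul_eq_mul]
    ring
  · intro f
    change Λ f = p f - (p f - Λ f)
    ring

/-- The integral of a real function against a difference of finite measures. -/
theorem integral_toSignedMeasure_sub {X : Type*} [MeasurableSpace X] {μ ν : Measure X}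
    [IsFiniteMeasure μ] [IsFiniteMeasure ν] {f : X → ℝ} (hμ : Integrable f μ)
    (hν : Integrable f ν) :
    ∫ᵛ x, f x ∂<•(μ.toSignedMeasure - ν.toSignedMeasure) = ∫ x, f x ∂μ - ∫ x, f x ∂ν := by
  rw [VectorMeasure.integral_sub_vectorMeasure, VectorMeasure.integral_toSignedMeasure,
    VectorMeasure.integral_toSignedMeasure]
  · simpa [VectorMeasure.Integrable] using hμ
  · simpa [VectorMeasure.Integrable] using hν

open CompactlySupported CompactlySupportedContinuousMap in
/-- **Riesz representation theorem** for continuous linear functionals on `C(X, ℝ)`, with `X`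
compact Hausdorff. -/
theorem exists_signedMeasure_forall_eq_integral {X : Type*} [TopologicalSpace X] [T2Space X]
    [CompactSpace X] [MeasurableSpace X] [BorelSpace X] (Λ : C(X, ℝ) →L[ℝ] ℝ) :
    ∃ μ : SignedMeasure X, ∀ f : C(X, ℝ), Λ f = ∫ᵛ x, f x ∂<•μ := by
  let Λ' : C_c(X, ℝ≥0) →ₗ[ℝ≥0] ℝ :=
    { toFun f := Λ f.toReal.toContinuousMap
      map_add' f g := by
        rw [← map_add]
        congr 1
        ext x
        simp
      map_smul' c f := by
        rw [NNReal.smul_def, ← map_smul]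
        congr 1
        ext x
        simp [NNReal.smul_def] }
  have hΛ' (f : C_c(X, ℝ≥0)) : BddAbove (Λ' '' Set.Iic f) := by
    refine ⟨‖Λ‖ * ‖f.toReal.toContinuousMap‖, ?_⟩
    rintro _ ⟨g, hg, rfl⟩
    refine (le_abs_self _).trans ((Λ.le_opNorm _).trans ?_)
    gcongr
    rw [ContinuousMap.norm_le _ (norm_nonneg _)]
    intro x
    refine le_trans ?_ (f.toReal.toContinuousMap.norm_coe_le_norm x)
    simpa using CompactlySupportedContinuousMap.le_def.1 hg x
  obtain ⟨P, N, hPN⟩ := exists_linearMap_nnreal_sub_eq Λ' hΛ'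
  refine ⟨(NNRealRMK.rieszMeasure P).toSignedMeasure -
    (NNRealRMK.rieszMeasure N).toSignedMeasure, fun f ↦ ?_⟩
  have hint (g : C(X, ℝ)) (μ : Measure X) [IsFiniteMeasure μ] : Integrable g μ :=
    (BoundedContinuousFunction.mkOfCompact g).integrable μ
  rw [integral_toSignedMeasure_sub (hint f _) (hint f _)]
  have key (g : C_c(X, ℝ≥0)) : Λ g.toReal.toContinuousMap =
      ∫ x, g.toReal.toContinuousMap x ∂(NNRealRMK.rieszMeasure P) -
      ∫ x, g.toReal.toContinuousMap x ∂(NNRealRMK.rieszMeasure N) := by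
    have h1 := NNRealRMK.integral_rieszMeasure P g
    have h2 := NNRealRMK.integral_rieszMeasure N g
    simp only [coe_toContinuousMap, toReal_apply, h1, h2]
    exact hPN g
  let F : C_c(X, ℝ) := continuousMapEquiv f
  -- `key` covers nonnegative functions only, so `f` is split into its positive and negative parts.
  have hf : f = F.nnrealPart.toReal.toContinuousMap - (-F).nnrealPart.toReal.toContinuousMap := by
    ext x
    exact (congr($(nnrealPart_sub_nnrealPart_neg F) x)).symm
  rw [hf, map_sub, key, key]
  simp only [ContinuousMap.sub_apply]
  rw [integral_sub (hint _ _) (hint _ _), integral_sub (hint _ _) (hint _ _)]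
  ring

/-- A signed measure is determined by its integrals of bounded continuous functions. -/
theorem signedMeasure_ext_of_forall_integral_eq {X : Type*} [TopologicalSpace X]
    [MeasurableSpace X] [HasOuterApproxClosed X] [BorelSpace X] {μ ν : SignedMeasure X}
    (h : ∀ f : X →ᵇ ℝ, ∫ᵛ x, f x ∂<•μ = ∫ᵛ x, f x ∂<•ν) : μ = ν := by
  rw [← μ.toSignedMeasure_toJordanDecomposition, ← ν.toSignedMeasure_toJordanDecomposition] at h ⊢
  simp only [JordanDecomposition.toSignedMeasure] at h ⊢
  -- Moving the negative Jordan parts across turns the claim into an equality of finite positive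
  -- measures.
  rw [sub_eq_sub_iff_add_eq_add, ← Measure.toSignedMeasure_add, ← Measure.toSignedMeasure_add]
  congr 1
  refine ext_of_forall_integral_eq_of_IsFiniteMeasure fun f ↦ ?_
  have hf := h f
  rw [integral_toSignedMeasure_sub (f.integrable _) (f.integrable _),
    integral_toSignedMeasure_sub (f.integrable _) (f.integrable _)] at hf
  rw [integral_add_measure (f.integrable _) (f.integrable _),
    integral_add_measure (f.integrable _) (f.integrable _)]
  linarith

/-! ### Splitting off the mass at infinity -/

/-- Signed Borel measures on `[0, ∞)` are regular. -/
theorem isRegularSigned_nnreal (ν : SignedMeasure ℝ≥0) : IsRegularSigned ν := by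
  unfold IsRegularSigned
  infer_instance

theorem addPointMassAtInfty_apply_image (ν : SignedMeasure ℝ≥0) (c : ℝ) {s : Set ℝ≥0}
    (hs : MeasurableSet s) : addPointMassAtInfty ν c ((↑) '' s : Set ℝ≥0∞) = ν s := by
  have hs' : MeasurableSet ((↑) '' s : Set ℝ≥0∞) :=
    ENNReal.isOpenEmbedding_coe.measurableEmbedding.measurableSet_image.2 hs
  rw [addPointMassAtInfty, add_apply, VectorMeasure.map_apply _ (by fun_prop) hs',
    Set.preimage_image_eq _ ENNReal.coe_injective, VectorMeasure.dirac_apply_of_notMem (by simp),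
    add_zero]

theorem addPointMassAtInfty_apply_top (ν : SignedMeasure ℝ≥0) (c : ℝ) :
    addPointMassAtInfty ν c {∞} = c := by
  rw [addPointMassAtInfty, add_apply,
    VectorMeasure.map_apply _ (by fun_prop) (measurableSet_singleton _),
    VectorMeasure.dirac_apply_of_mem (measurableSet_singleton _) rfl]
  have : ((↑) : ℝ≥0 → ℝ≥0∞) ⁻¹' {∞} = ∅ := by ext; simp
  simp [this]

theorem addPointMassAtInfty_bijective :
    Function.Bijective fun p : SignedMeasure ℝ≥0 × ℝ ↦ addPointMassAtInfty p.1 p.2 := by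
  constructor
  · rintro ⟨ν, c⟩ ⟨ν', c'⟩ h
    simp only at h
    refine Prod.ext (VectorMeasure.ext fun s hs ↦ ?_) ?_
    · rw [← addPointMassAtInfty_apply_image ν c hs, h, addPointMassAtInfty_apply_image ν' c' hs]
    · rw [← addPointMassAtInfty_apply_top ν c, h, addPointMassAtInfty_apply_top ν' c']
  · intro μ
    have hm : MeasurableSet ({∞}ᶜ : Set ℝ≥0∞) := (measurableSet_singleton _).compl
    -- Since `ENNReal.toNNReal` sends `∞` to `0`, the point `∞` is removed before pushing forward;
    -- otherwise its mass would land at `0`.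
    refine ⟨((μ.restrict {∞}ᶜ).map ENNReal.toNNReal, μ {∞}), VectorMeasure.ext fun s hs ↦ ?_⟩
    have h1 : Measurable ((↑) : ℝ≥0 → ℝ≥0∞) := by fun_prop
    simp only [addPointMassAtInfty]
    rw [add_apply, VectorMeasure.map_apply _ h1 hs,
      VectorMeasure.map_apply _ ENNReal.measurable_toNNReal (h1 hs),
      VectorMeasure.restrict_apply _ hm (ENNReal.measurable_toNNReal (h1 hs))]
    have h2 : ENNReal.toNNReal ⁻¹' ((↑) ⁻¹' s) ∩ {∞}ᶜ = s \ {∞} := by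
      ext t
      induction t <;> simp
    rw [h2]
    by_cases ht : ∞ ∈ s
    · rw [VectorMeasure.dirac_apply_of_mem hs ht, add_comm,
        VectorMeasure.of_add_of_sdiff (measurableSet_singleton _) hs (by simpa using ht)]
    · rw [VectorMeasure.dirac_apply_of_notMem ht, add_zero, Set.sdiff_singleton_eq_self ht]

/-- Every signed Borel measure on `[0, ∞]` belongs to `M([0, ∞])`. -/
theorem mem_extendedMeasures (μ : SignedMeasure ℝ≥0∞) : μ ∈ extendedMeasures := by
  obtain ⟨p, hp, huniq⟩ := addPointMassAtInfty_bijective.existsUnique μ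
  exact ⟨p, ⟨isRegularSigned_nnreal _, hp.symm⟩, fun q hq ↦ huniq q hq.2.symm⟩

/-- A bounded continuous function is integrable for every signed Borel measure. -/
theorem BoundedContinuousFunction.integrable_signedMeasure {X : Type*} [TopologicalSpace X]
    [MeasurableSpace X] [OpensMeasurableSpace X] (f : X →ᵇ ℝ) (ν : SignedMeasure X) :
    ν.Integrable f := by
  have : IsFiniteMeasure ν.variation := by
    rw [← SignedMeasure.totalVariation_eq_variation]
    infer_instance
  exact f.integrable _

/-! ### Identification with continuous functions on the compactification -/

namespace CLim

variable {n : ℕ}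

@[simp]
theorem extend_coe (x : CLim n) (t : ℝ≥0) : extend x t = x.1 t := by simp [extend]

@[simp]
theorem extend_top (x : CLim n) : extend x ∞ = atInfty x := by simp [extend]

theorem continuous_extend (x : CLim n) : Continuous (extend x) := by
  rw [continuous_iff_continuousAt]
  intro t
  induction t with
  | top =>
    rw [ContinuousAt, extend_top]
    refine tendsto_def.2 fun U hU ↦ ?_
    obtain ⟨T, hT⟩ := eventually_atTop.1 ((tendsto_atInfty x).eventually hU)
    filter_upwards [lt_mem_nhds (ENNReal.coe_lt_top (r := T))] with t ht
    induction t with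
    | top => simpa using mem_of_mem_nhds hU
    | coe t =>
      rw [Set.mem_preimage, extend_coe]
      exact hT t (ENNReal.coe_lt_coe.1 ht).le
  | coe t =>
    rw [ENNReal.isOpenEmbedding_coe.continuousAt_iff.symm]
    simpa [Function.comp_def] using x.1.continuous.continuousAt

/-- The `i`-th coordinate of `x`, as a continuous function on `[0, ∞]`. -/
noncomputable def extendCoord (x : CLim n) (i : Fin n) : C(ℝ≥0∞, ℝ) where
  toFun t := extend x t i
  continuous_toFun := by
    have := continuous_extend x
    fun_prop

@[simp]
theorem extendCoord_apply (x : CLim n) (i : Fin n) (t : ℝ≥0∞) :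
    extendCoord x i t = extend x t i := rfl

/-- The restriction of a continuous function on `[0, ∞]` to `[0, ∞)`. -/
noncomputable def ofContinuousMap :
    C(ℝ≥0∞, EuclideanSpace ℝ (Fin n)) →L[ℝ] CLim n :=
  LinearMap.mkContinuous
    { toFun f := (⟨BoundedContinuousFunction.compContinuous
          (BoundedContinuousFunction.mkOfCompact f) ⟨((↑) : ℝ≥0 → ℝ≥0∞), by fun_prop⟩,
        f ∞, (f.continuous.tendsto ∞).comp (ENNReal.tendsto_coe_nhds_top.2 tendsto_id)⟩ : CLim n)
      map_add' f g := rfl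
      map_smul' c f := rfl } 1 fun f ↦ by
      rw [one_mul]
      exact (BoundedContinuousFunction.norm_le (norm_nonneg _)).2 fun t ↦ f.norm_coe_le_norm t

@[simp]
theorem ofContinuousMap_apply (f : C(ℝ≥0∞, EuclideanSpace ℝ (Fin n))) (t : ℝ≥0) :
    (ofContinuousMap f).1 t = f t := rfl

@[simp]
theorem extend_ofContinuousMap (f : C(ℝ≥0∞, EuclideanSpace ℝ (Fin n))) :
    extend (ofContinuousMap f) = f := by
  ext1 t
  induction t with
  | top =>
    rw [extend_top]
    exact tendsto_nhds_unique (tendsto_atInfty _)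
      ((f.continuous.tendsto ∞).comp (ENNReal.tendsto_coe_nhds_top.2 tendsto_id))
  | coe t => rw [extend_coe, ofContinuousMap_apply]

/-- The element of `CLim n` with `i`-th coordinate `f` and other coordinates zero. -/
noncomputable def single (i : Fin n) : C(ℝ≥0∞, ℝ) →L[ℝ] CLim n :=
  ofContinuousMap.comp (ContinuousLinearMap.compLeftContinuous ℝ ℝ≥0∞
    (ContinuousLinearMap.toSpanSingleton ℝ (EuclideanSpace.single i (1 : ℝ))))

theorem extend_single_apply (i j : Fin n) (f : C(ℝ≥0∞, ℝ)) (t : ℝ≥0∞) :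
    extend (single i f) t j = if j = i then f t else 0 := by
  simp [single]

theorem sum_single_extendCoord (x : CLim n) : ∑ i, single i (extendCoord x i) = x := by
  refine Subtype.ext (BoundedContinuousFunction.ext fun t ↦ ?_)
  ext j
  have h (i : Fin n) : (single i (extendCoord x i)).1 t j = if j = i then x.1 t j else 0 := by
    rw [← extend_coe, extend_single_apply]
    split_ifs with hij
    · rw [extendCoord_apply, extend_coe, hij]
    · rfl
  simp [h]

end CLim

/-! ### The two representations and their equivalence -/

/-- Every continuous linear functional on `CLim n` is given by signed measures on `[0, ∞]`. -/
theorem exists_isRepresentedByExtended {n : ℕ} (φ : CLim n →L[ℝ] ℝ) :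
    ∃ μ : Fin n → SignedMeasure ℝ≥0∞, IsRepresentedByExtended φ μ := by
  choose μ hμ using fun i ↦ exists_signedMeasure_forall_eq_integral (φ.comp (CLim.single i))
  refine ⟨μ, fun x ↦ ?_⟩
  conv_lhs => rw [← CLim.sum_single_extendCoord x, map_sum]
  exact Finset.sum_congr rfl fun i _ ↦ hμ i (CLim.extendCoord x i)

/-- Testing `φ` on `CLim.single i f` isolates the `i`-th measure, and `f` ranges over all continuous
functions on $[0,\infty]$. -/
theorem IsRepresentedByExtended.unique {n : ℕ} {φ : CLim n →L[ℝ] ℝ}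
    {μ μ' : Fin n → SignedMeasure ℝ≥0∞} (h : IsRepresentedByExtended φ μ)
    (h' : IsRepresentedByExtended φ μ') : μ = μ' := by
  funext i
  refine signedMeasure_ext_of_forall_integral_eq fun f ↦ ?_
  have key {ν : Fin n → SignedMeasure ℝ≥0∞} (hν : IsRepresentedByExtended φ ν) :
      φ (CLim.single i f.toContinuousMap) = ∫ᵛ t, f t ∂<•(ν i) := by
    rw [hν, pairingIntegral, Finset.sum_eq_single i]
    · simp [CLim.extend_single_apply]
    · intro j _ hj
      simp [CLim.extend_single_apply, hj]
    · simp
  rw [← key h, ← key h']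

theorem integral_addPointMassAtInfty (f : C(ℝ≥0∞, ℝ)) (ν : SignedMeasure ℝ≥0) (c : ℝ) :
    ∫ᵛ t, f t ∂<•(addPointMassAtInfty ν c) = ∫ᵛ t : ℝ≥0, f t ∂<•ν + f ∞ * c := by
  have h : (ν.map ((↑) : ℝ≥0 → ℝ≥0∞)).Integrable f :=
    (BoundedContinuousFunction.mkOfCompact f).integrable_signedMeasure _
  have h' : (VectorMeasure.dirac ∞ c : SignedMeasure ℝ≥0∞).Integrable f :=
    (BoundedContinuousFunction.mkOfCompact f).integrable_signedMeasure _
  rw [addPointMassAtInfty, VectorMeasure.integral_add_vectorMeasure h h',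
    ENNReal.isOpenEmbedding_coe.measurableEmbedding.integral_map_vectorMeasure,
    VectorMeasure.integral_dirac]
  simp [mul_comm]

theorem integral_sub_const_signedMeasure (f : ℝ≥0 →ᵇ ℝ) (c : ℝ) (ν : SignedMeasure ℝ≥0) :
    ∫ᵛ t, (f t - c) ∂<•ν = ∫ᵛ t, f t ∂<•ν - c * ν Set.univ := by
  have : IsFiniteMeasure ν.variation := by
    rw [← SignedMeasure.totalVariation_eq_variation]
    infer_instance
  rw [VectorMeasure.integral_fun_sub (f.integrable_signedMeasure ν) (integrable_const c),
    VectorMeasure.integral_const]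
  simp [mul_comm]

/-- The point mass contributes `α i` times the limit, and its correction `- ν i Set.univ` accounts
for the constant subtracted under the integral. -/
theorem pairingIntegral_extend_addPointMassAtInfty {n : ℕ} (x : CLim n)
    (ν : Fin n → SignedMeasure ℝ≥0) (α : EuclideanSpace ℝ (Fin n)) :
    pairingIntegral (CLim.extend x)
        (fun i ↦ addPointMassAtInfty (ν i) (α i - ν i Set.univ)) =
      pairingIntegral (fun t ↦ x.1 t - CLim.atInfty x) ν + inner ℝ α (CLim.atInfty x) := by
  simp only [pairingIntegral, PiLp.inner_apply]
  rw [← Finset.sum_add_distrib]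
  refine Finset.sum_congr rfl fun i _ ↦ ?_
  let f : ℝ≥0 →ᵇ ℝ := (BoundedContinuousFunction.mkOfCompact (CLim.extendCoord x i)).compContinuous
    ⟨((↑) : ℝ≥0 → ℝ≥0∞), by fun_prop⟩
  have hf (t : ℝ≥0) : f t = x.1 t i := by
    change CLim.extend x t i = _
    rw [CLim.extend_coe]
  have h1 := integral_addPointMassAtInfty (CLim.extendCoord x i) (ν i) (α i - ν i Set.univ)
  have h2 := integral_sub_const_signedMeasure f (CLim.atInfty x i) (ν i)
  simp only [CLim.extendCoord_apply, CLim.extend_coe, CLim.extend_top] at h1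
  simp only [hf] at h2
  simp only [PiLp.sub_apply, h1, h2]
  simp
  ring

theorem isRepresentedBy_iff {n : ℕ} (φ : CLim n →L[ℝ] ℝ) (ν : Fin n → SignedMeasure ℝ≥0)
    (α : EuclideanSpace ℝ (Fin n)) :
    IsRepresentedBy φ ν α ↔ IsRepresentedByExtended φ
      (fun i ↦ addPointMassAtInfty (ν i) (α i - ν i Set.univ)) := by
  refine forall_congr' fun x ↦ ?_
  rw [pairingIntegral_extend_addPointMassAtInfty]
  -- The two formulas in `IsRepresentedBy` agree by definition of `CLim.zeroPart`.
  exact and_self_iff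

theorem mainTheorem9 (n : ℕ) (φ : CLim n →L[ℝ] ℝ) :
    (∃! p : (Fin n → SignedMeasure ℝ≥0) × EuclideanSpace ℝ (Fin n),
      (∀ i, IsRegularSigned (p.1 i)) ∧ IsRepresentedBy φ p.1 p.2) ∧
    (∃! μ : Fin n → SignedMeasure ℝ≥0∞,
      (∀ i, μ i ∈ extendedMeasures) ∧ IsRepresentedByExtended φ μ) ∧
    (∀ (ν : Fin n → SignedMeasure ℝ≥0) (α : EuclideanSpace ℝ (Fin n)),
      (∀ i, IsRegularSigned (ν i)) →
      (∀ i, addPointMassAtInfty (ν i) (α i - ν i Set.univ) ∈ extendedMeasures) ∧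
      (IsRepresentedBy φ ν α ↔
        IsRepresentedByExtended φ
          (fun i ↦ addPointMassAtInfty (ν i) (α i - ν i Set.univ)))) := by
  refine ⟨?_, ?_, fun ν α _ ↦ ⟨fun i ↦ mem_extendedMeasures _, isRepresentedBy_iff φ ν α⟩⟩
  · obtain ⟨μ, hμ⟩ := exists_isRepresentedByExtended φ
    choose p hp using fun i ↦ addPointMassAtInfty_bijective.surjective (μ i)
    -- Solves `α i - ν i Set.univ = (p i).2` for `α`.
    refine ⟨(fun i ↦ (p i).1, WithLp.toLp 2 fun i ↦ (p i).2 + (p i).1 Set.univ),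
      ⟨fun i ↦ isRegularSigned_nnreal _, ?_⟩, ?_⟩
    · rw [isRepresentedBy_iff]
      simpa [hp] using hμ
    · rintro ⟨ν, α⟩ ⟨-, h⟩
      have h' := ((isRepresentedBy_iff φ ν α).1 h).unique hμ
      have key (i : Fin n) : (ν i, α i - ν i Set.univ) = p i :=
        addPointMassAtInfty_bijective.injective ((congrFun h' i).trans (hp i).symm)
      refine Prod.ext (funext fun i ↦ congrArg Prod.fst (key i)) ?_
      ext i
      simp [← key i]
  · obtain ⟨μ, hμ⟩ := exists_isRepresentedByExtended φ
    exact ⟨μ, ⟨fun i ↦ mem_extendedMeasures _, hμ⟩, fun μ' h ↦ h.2.unique hμ⟩
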